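/- For a real number $x$ let $\Vert x\Vert$ denote its distance to the nearest integer. For $\zeta\in\mathbb{R}$ let $\lambda_1(\zeta)\in[-\infty,\infty]$ be the supremum of all real $\mu$ such that $\Vert x\zeta\Vert\le x^{-\mu}$ has arbitrarily large integer solutions $x$. For $\underline{\zeta}=(\zeta_1,\ldots,\zeta_k)\in\mathbb{R}^k$ let $\chi_k(\underline{\zeta})\in[-\infty,\infty]$ be the supremum of all real $\nu>0$ such that, for arbitrarily large real $X$, there exists $(x_1,\ldots,x_k)\in\mathbb{Z}^k$ with \[ 0<\min_{1\le j\le k}|x_j|\le\max_{1\le j\le k}|x_j|\le X,\qquad \max_{1\le j\le k}\Vert x_j\zeta_j\Vert\le X^{-\nu}. \] Let $k\ge 2$ be an integer and let $\lambda_1,\ldots,\lambda_k,w$ be real numbers with $1\le w\le\min_{1\le j\le k}\lambda_j$. Then there exist uncountably many vectors $(\zeta_1,\ldots,\zeta_k)\in\mathbb{R}^k$ such that $1,\zeta_1,\ldots,\zeta_k$ are linearly independent over $\mathbb{Q}$, $\lambda_1(\zeta_j)=\lambda_j$ for every $1\le j\le k$, and $\chi_k(\zeta_1,\ldots,\zeta_k)=w$.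 -/

import Mathlib

open Filter

/-- The distance `‖x‖` of a real number to the nearest integer. -/
noncomputable def distInt (x : ℝ) : ℝ := |x - round x|

/-- The classical exponent `λ₁(ζ)`: the supremum in `[-∞, ∞]` of all real `μ` such that
`‖x ζ‖ ≤ x ^ (-μ)` has arbitrarily large integer solutions `x`. -/
noncomputable def lambdaOne (ζ : ℝ) : EReal :=
  sSup {e : EReal | ∃ μ : ℝ, e = (μ : EReal) ∧
    ∃ᶠ x : ℕ in atTop, distInt ((x : ℝ) * ζ) ≤ (x : ℝ) ^ (-μ)}

/-- The set of `ζ ∈ ℝ ^ k` such that, for arbitrarily large real `X`, there are integers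
`x₁, …, x_k` with `0 < min |x_j|`, `max |x_j| ≤ X` and `max ‖x_j ζ_j‖ ≤ ψ X`. -/
def chiSet (k : ℕ) (ψ : ℝ → ℝ) : Set (Fin k → ℝ) :=
  {ζ | ∃ᶠ X : ℝ in atTop, ∃ x : Fin k → ℤ,
    ∀ j, 0 < |x j| ∧ (|x j| : ℝ) ≤ X ∧ distInt ((x j : ℝ) * ζ j) ≤ ψ X}

/-- The exponent `χ_k(ζ)`: the supremum in `[-∞, ∞]` of all real `ν > 0` such that `ζ` belongs to
`chiSet k ψ` for `ψ t = t ^ (-ν)`. -/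
noncomputable def chiExponent (k : ℕ) (ζ : Fin k → ℝ) : EReal :=
  sSup {e : EReal | ∃ ν : ℝ, e = (ν : EReal) ∧ 0 < ν ∧ ζ ∈ chiSet k (fun t : ℝ => t ^ (-ν))}

/-! Each `ζ j` is a limit of fractions with denominators prescribed up to a bounded factor: a
denominator near `16 ^ m` is followed by one near `16 ^ (lam j * m)` if `m` lies in a sparse set,
and by one near `16 ^ (m + 1)` otherwise (`HasGaps`). This alone gives `λ₁(ζ_j) = λ_j`.

One index `i₀` uses the fast growing set `{t i}`, all others use `{s i}` with `s i ≈ lam i₀ * t i /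
w`. At `X ≈ 16 ^ s i` the number `ζ i₀` is approximated to about `X ^ (-w)`, and the others at least
as well since `w ≤ lam j`. Conversely, an exponent above `w` needs good denominators for both
sequences at one scale `X`, and the interlacing of `t` and `s` prevents this for large `X`
(`chiExponent_eq_of_hasGaps`).

The construction can avoid any given sequence of reals, so every coordinate has uncountably many
choices, which also leaves room for linear independence. -/

lemma distInt_le (x : ℝ) (n : ℤ) : distInt x ≤ |x - n| := round_le x n

lemma exists_int_distInt (x : ℝ) : ∃ n : ℤ, distInt x = |x - n| := ⟨round x, rfl⟩

/-! ### Real numbers with prescribed denominators -/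

/-- From a reduced fraction `p / q` one can pass to a Farey neighbour `p' / q'` whose denominator
has a prescribed size, while keeping a whole neighbourhood to the right of `p' / q'` away
from a given real number. -/
lemma exists_farey_neighbour (p q : ℤ) (hq : 0 < q) (hpq : IsCoprime p q) (T : ℤ) (hT : 8 * q ≤ T)
    (c : ℝ) : ∃ p' q' : ℤ, T ≤ q' ∧ q' ≤ 2 * T ∧ IsCoprime p' q' ∧ p' * q - p * q' = 1 ∧
      ∀ z : ℝ, (p' / q' : ℝ) ≤ z → z ≤ p' / q' + 1 / (4 * q' ^ 2) → z ≠ c := by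
  obtain ⟨v, u, huv⟩ := hpq
  -- the two smallest admissible denominators
  obtain ⟨t, ht1, ht2⟩ : ∃ t : ℤ, T ≤ -v + t * q ∧ -v + t * q < T + q := by
    refine ⟨-((-(T + v)) / q), ?_, ?_⟩
    · have := Int.ediv_mul_le (-(T + v)) hq.ne'
      linarith
    · have := Int.lt_ediv_add_one_mul_self (-(T + v)) hq
      linarith
  have cop : ∀ s : ℤ, (u + s * p) * q - p * (-v + s * q) = 1 := fun s => by linear_combination huv
  have key : ∀ s : ℤ, IsCoprime (u + s * p) (-v + s * q) :=
    fun s => ⟨q, -p, by linear_combination cop s⟩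
  have hqR : (0 : ℝ) < q := by exact_mod_cast hq
  have hfrac : ∀ s : ℤ, 0 < -v + s * q →
      ((u + s * p : ℤ) / (-v + s * q : ℤ) : ℝ) = p / q + 1 / (q * (-v + s * q : ℤ)) := by
    intro s hs
    have hs' : (0 : ℝ) < (-v + s * q : ℤ) := by exact_mod_cast hs
    have h1 : ((u + s * p : ℤ) : ℝ) * q - p * (-v + s * q : ℤ) = 1 := by exact_mod_cast cop s
    field_simp
    linarith
  -- With `r` the first denominator, the candidates are `p/q + 1/(q r)` and `p/q + 1/(q (r + q))`.
  -- The interval right of the second ends before the first, so `c` cannot obstruct both.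
  by_cases hc : c < ((u + t * p : ℤ) / (-v + t * q : ℤ) : ℝ)
  · refine ⟨u + t * p, -v + t * q, ht1, by linarith, key t, cop t, ?_⟩
    intro z hz _ hzc
    linarith
  · have e : -v + (t + 1) * q = (-v + t * q) + q := by ring
    refine ⟨u + (t + 1) * p, -v + (t + 1) * q, by linarith, by linarith, key _, cop _, ?_⟩
    intro z _ hz hzc
    have pos1 : 0 < -v + t * q := by linarith
    have pos2 : 0 < -v + (t + 1) * q := by linarith
    rw [hfrac t pos1] at hc
    rw [hfrac (t + 1) pos2] at hz
    have e' : ((-v + (t + 1) * q : ℤ) : ℝ) = ((-v + t * q : ℤ) : ℝ) + q := by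
      rw [e]; push_cast; ring
    rw [e'] at hz
    have hb : (8 * q : ℝ) ≤ (-v + t * q : ℤ) := by exact_mod_cast hT.trans ht1
    generalize ((-v + t * q : ℤ) : ℝ) = r at *
    have hr : 0 < r := by linarith
    have h1 : 1 / (q * (r + q)) + 1 / (4 * (r + q) ^ 2) < 1 / ((q : ℝ) * r) := by
      have h2 : 1 / ((q : ℝ) * r) - 1 / (q * (r + q)) = 1 / (r * (r + q)) := by
        field_simp
        ring
      have h3 : 1 / (4 * (r + q) ^ 2) < 1 / (r * (r + q)) := by
        apply one_div_lt_one_div_of_lt (by positivity)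
        nlinarith
      linarith
    linarith

/-- For a strictly increasing sequence `b`, there is a real number outside a given countable set
whose convergents have denominators in `[16 ^ b n, 2 * 16 ^ b n]`. -/
lemma exists_approx_sequence (b : ℕ → ℕ) (hb : StrictMono b) (c : ℕ → ℝ) :
    ∃ z : ℝ, (∀ n, z ≠ c n) ∧
      (∀ n, ∃ x : ℕ, 16 ^ b n ≤ x ∧ x ≤ 2 * 16 ^ b n ∧
        distInt ((x : ℝ) * z) ≤ 2 / 16 ^ b (n + 1)) ∧
      ∀ (n : ℕ) (x : ℤ), x ≠ 0 → |x| < 16 ^ b n →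
        1 / (4 * 16 ^ b n) ≤ distInt ((x : ℝ) * z) := by
  let St (n : ℕ) := {s : ℤ × ℤ // (16 ^ b n ≤ s.2 ∧ s.2 ≤ 2 * 16 ^ b n) ∧ IsCoprime s.1 s.2}
  have step : ∀ n (s : St n), ∃ s' : St (n + 1), s'.1.1 * s.1.2 - s.1.1 * s'.1.2 = 1 ∧
      ∀ z : ℝ, (s'.1.1 / s'.1.2 : ℝ) ≤ z → z ≤ s'.1.1 / s'.1.2 + 1 / (4 * s'.1.2 ^ 2) →
        z ≠ c n := by
    rintro n ⟨⟨p, q⟩, ⟨h1, h2⟩, h3⟩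
    have hpos : (0 : ℤ) < 16 ^ b n := by positivity
    have h16 : (16 : ℤ) * 16 ^ b n ≤ 16 ^ b (n + 1) := by
      rw [← pow_succ']
      exact pow_le_pow_right₀ (by norm_num) (hb n.lt_succ_self)
    obtain ⟨p', q', h4, h5, h6, h7, h8⟩ :=
      exists_farey_neighbour p q (by dsimp at *; linarith) h3 (16 ^ b (n + 1))
        (by dsimp at *; linarith) (c n)
    exact ⟨⟨(p', q'), ⟨h4, h5⟩, h6⟩, h7, h8⟩
  choose f hf1 hf2 using step
  let s0 : St 0 := ⟨(1, 16 ^ b 0), ⟨le_rfl, by dsimp; linarith [pow_pos (by norm_num : (0 : ℤ) < 16) (b 0)]⟩,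
    isCoprime_one_left⟩
  let s : ∀ n, St n := fun n => Nat.rec s0 f n
  have hs : ∀ n, s (n + 1) = f n (s n) := fun n => rfl
  obtain ⟨p, hp⟩ : ∃ p : ℕ → ℤ, p = fun n => (s n).1.1 := ⟨_, rfl⟩
  obtain ⟨q, hq⟩ : ∃ q : ℕ → ℤ, q = fun n => (s n).1.2 := ⟨_, rfl⟩
  have hq1 : ∀ n, 16 ^ b n ≤ q n := fun n => by rw [hq]; exact (s n).2.1.1
  have hq2 : ∀ n, q n ≤ 2 * 16 ^ b n := fun n => by rw [hq]; exact (s n).2.1.2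
  have hco : ∀ n, IsCoprime (p n) (q n) := fun n => by rw [hp, hq]; exact (s n).2.2
  have hdet : ∀ n, p (n + 1) * q n - p n * q (n + 1) = 1 := fun n => by
    rw [hp, hq]; exact hf1 n (s n)
  have hne : ∀ n (z : ℝ), (p (n + 1) / q (n + 1) : ℝ) ≤ z →
      z ≤ p (n + 1) / q (n + 1) + 1 / (4 * q (n + 1) ^ 2) → z ≠ c n := fun n => by
    rw [hp, hq]; exact hf2 n (s n)
  clear_value s
  clear hs hp hq hf1 hf2 f
  have hpos : ∀ n, 0 < q n := fun n => lt_of_lt_of_le (by positivity) (hq1 n)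
  have hposR : ∀ n, (0 : ℝ) < q n := fun n => by exact_mod_cast hpos n
  have hq8 : ∀ n, 8 * q n ≤ q (n + 1) := fun n => by
    have h16 : (16 : ℤ) * 16 ^ b n ≤ 16 ^ b (n + 1) := by
      rw [← pow_succ']
      exact pow_le_pow_right₀ (by norm_num) (hb n.lt_succ_self)
    linarith [hq1 (n + 1), hq2 n]
  have hq8R : ∀ n, (8 * q n : ℝ) ≤ q (n + 1) := fun n => by exact_mod_cast hq8 n
  have hA : ∀ n, (p (n + 1) / q (n + 1) : ℝ) = p n / q n + 1 / (q n * q (n + 1)) := by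
    intro n
    have h1 : (p (n + 1) * q n - p n * q (n + 1) : ℝ) = 1 := by exact_mod_cast hdet n
    have := hposR n
    have := hposR (n + 1)
    field_simp
    linarith
  have mono : Monotone fun n => (p n / q n : ℝ) := by
    apply monotone_nat_of_le_succ
    intro n
    have := hposR n
    have := hposR (n + 1)
    have : (0 : ℝ) ≤ 1 / (q n * q (n + 1)) := by positivity
    rw [hA n]
    linarith
  -- The factor 2 absorbs all later increments, since the denominators grow at least by a factor 8.
  have anti : Antitone fun n => (p n / q n + 2 / (q n * q (n + 1)) : ℝ) := by
    apply antitone_nat_of_succ_le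
    intro n
    have h0 := hposR n
    have h1 := hposR (n + 1)
    have h2 := hposR (n + 2)
    have : (2 / (q (n + 1) * q (n + 2)) : ℝ) ≤ 1 / (q n * q (n + 1)) := by
      rw [div_le_div_iff₀ (by positivity) (by positivity)]
      nlinarith [hq8R n, hq8R (n + 1), mul_pos h0 h1]
    have e : (2 / (q n * q (n + 1)) : ℝ) = 1 / (q n * q (n + 1)) + 1 / (q n * q (n + 1)) := by
      ring
    simp only [hA n, e]
    linarith
  have hz := mono.ciSup_mem_iInter_Icc_of_antitone anti (fun n => by
    have := hposR n
    have := hposR (n + 1)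
    have : (0 : ℝ) ≤ 2 / (q n * q (n + 1)) := by positivity
    dsimp
    linarith)
  generalize (⨆ n, (p n / q n : ℝ)) = z at hz
  simp only [Set.mem_iInter, Set.mem_Icc] at hz
  have hd : ∀ n, 0 ≤ q n * z - p n ∧ q n * z - p n ≤ 2 / q (n + 1) := by
    intro n
    have h0 := hposR n
    have h1 := hposR (n + 1)
    obtain ⟨h2, h3⟩ := hz n
    rw [div_le_iff₀ h0] at h2
    refine ⟨by linarith, ?_⟩
    have h4 : (p n / q n + 2 / (q n * q (n + 1)) : ℝ) * q n = p n + 2 / q (n + 1) := by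
      field_simp
    have := mul_le_mul_of_nonneg_right h3 h0.le
    linarith
  refine ⟨z, fun n => hne n z (hz _).1 ((hz (n + 1)).2.trans ?_), fun n => ?_, fun n x hx hxn => ?_⟩
  · have h1 := hposR (n + 1)
    have h2 := hposR (n + 2)
    have : (2 / (q (n + 1) * q (n + 2)) : ℝ) ≤ 1 / (4 * q (n + 1) ^ 2) := by
      rw [div_le_div_iff₀ (by positivity) (by positivity)]
      nlinarith [hq8R (n + 1)]
    linarith
  · obtain ⟨x, hx⟩ := Int.eq_ofNat_of_zero_le (hpos n).le
    refine ⟨x, ?_, ?_, ?_⟩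
    · have := hq1 n
      rw [hx] at this
      exact_mod_cast this
    · have := hq2 n
      rw [hx] at this
      exact_mod_cast this
    · have hxR : (x : ℝ) = q n := by rw [hx]; simp
      rw [hxR]
      refine (distInt_le _ (p n)).trans ?_
      rw [abs_of_nonneg (hd n).1]
      refine (hd n).2.trans ?_
      gcongr
      exact_mod_cast hq1 (n + 1)
  · obtain ⟨y, hy⟩ := exists_int_distInt ((x : ℝ) * z)
    rw [hy]
    have h0 := hposR n
    have h1 := hposR (n + 1)
    have hxq : |x| < q n := hxn.trans_le (hq1 n)
    -- A nonzero integer has absolute value at least 1, and replacing `p n / q n` by `z` costs at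
    -- most 1/2 of it.
    have hint : x * p n - y * q n ≠ 0 := by
      intro h
      have hdvd : q n ∣ x * p n := ⟨y, by linarith⟩
      have := (hco n).symm.dvd_of_dvd_mul_right hdvd
      have := Int.le_of_dvd (abs_pos.2 hx) ((dvd_abs _ _).2 this)
      linarith
    have h2 : 1 ≤ |(x * p n - y * q n : ℝ)| := by exact_mod_cast Int.one_le_abs hint
    have h3 : |(x : ℝ) * (q n * z - p n)| ≤ 1 / 2 := by
      rw [abs_mul, abs_of_nonneg (hd n).1]
      have hx' : |(x : ℝ)| ≤ q n := by exact_mod_cast hxq.le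
      calc |(x : ℝ)| * (q n * z - p n) ≤ q n * (2 / q (n + 1)) :=
            mul_le_mul hx' (hd n).2 (hd n).1 h0.le
        _ ≤ 1 / 2 := by
            rw [← mul_div_assoc, div_le_div_iff₀ h1 (by norm_num)]
            linarith [hq8R n]
    have h4 : (x * p n - y * q n : ℝ) = q n * (x * z - y) - x * (q n * z - p n) := by ring
    have h5 : (1 : ℝ) / 2 ≤ q n * |x * z - y| := by
      have := abs_sub (q n * (x * z - y)) ((x : ℝ) * (q n * z - p n))
      rw [← h4, abs_mul (q n : ℝ), abs_of_pos h0] at this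
      linarith
    have h6 : (q n : ℝ) ≤ 2 * 16 ^ b n := by exact_mod_cast hq2 n
    rw [div_le_iff₀ (by positivity)]
    nlinarith [abs_nonneg (x * z - y)]

/-! ### Numbers well approximable only along a sparse set -/

/-- The real number `z` has, for every `m ∈ S`, an approximation of exponent `lam` with
denominator about `16 ^ m`, and it is badly approximable except for these. -/
def HasGaps (lam : ℝ) (S : Set ℕ) (z : ℝ) : Prop :=
  (∀ m ∈ S, ∃ x : ℕ, (16 : ℝ) ^ (m : ℝ) ≤ x ∧ (x : ℝ) ≤ 16 ^ (m + 1 : ℝ) ∧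
    distInt (x * z) ≤ 16 ^ (1 - lam * m)) ∧
  ∀ x : ℤ, x ≠ 0 → (16 : ℝ) ^ (-2 : ℝ) * |(x : ℝ)|⁻¹ ≤ distInt (x * z) ∨
    ∃ m ∈ S, (16 : ℝ) ^ (m : ℝ) ≤ |(x : ℝ)| ∧ |(x : ℝ)| < 16 ^ (lam * m + 1) ∧
      (16 : ℝ) ^ (-(lam * m + 2)) ≤ distInt (x * z)

lemma exists_hasGaps {lam : ℝ} (hlam : 1 ≤ lam) {S : Set ℕ}
    (hS : ∀ m ∈ S, ∀ m' ∈ S, m < m' → lam * m + 1 ≤ m') (c : ℕ → ℝ) :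
    ∃ z, HasGaps lam S z ∧ ∀ n, z ≠ c n := by
  classical
  -- `f` sends the exponent of one denominator to the exponent of the next.
  obtain ⟨f, hf⟩ : ∃ f : ℕ → ℕ, f = fun m => if m ∈ S then ⌊lam * m⌋₊ + 1 else m + 1 := ⟨_, rfl⟩
  have hf1 : ∀ m ∈ S, lam * m ≤ f m ∧ (f m : ℝ) ≤ lam * m + 1 := by
    intro m hm
    simp only [hf, if_pos hm]
    push_cast
    exact ⟨(Nat.lt_floor_add_one _).le, by linarith [Nat.floor_le (a := lam * m) (by positivity)]⟩
  have hf2 : ∀ m ∉ S, f m = m + 1 := fun m hm => by simp only [hf, if_neg hm]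
  have hfm : ∀ m, m < f m := by
    intro m
    by_cases hm : m ∈ S
    · simp only [hf, if_pos hm]
      refine Nat.lt_succ_of_le (Nat.le_floor ?_)
      nlinarith [(Nat.cast_nonneg m : (0 : ℝ) ≤ m)]
    · rw [hf2 m hm]
      exact m.lt_succ_self
  have hfS : ∀ m, ∀ m' ∈ S, m < m' → f m ≤ m' := by
    intro m m' hm' hlt
    by_cases hm : m ∈ S
    · exact_mod_cast (hf1 m hm).2.trans (hS m hm m' hm' hlt)
    · rw [hf2 m hm]
      exact hlt
  clear hf
  obtain ⟨b, hb0, hbs⟩ : ∃ b : ℕ → ℕ, b 0 = 0 ∧ ∀ n, b (n + 1) = f (b n) :=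
    ⟨fun n => Nat.rec 0 (fun _ m => f m) n, rfl, fun n => rfl⟩
  have hb : StrictMono b := strictMono_nat_of_lt_succ fun n => by rw [hbs]; exact hfm _
  have hloc : ∀ m, ∃ n, b n ≤ m ∧ m < b (n + 1) := by
    intro m
    have hex : ∃ n, m < b n := ⟨m + 1, hb.le_apply⟩
    obtain ⟨n, hn⟩ : ∃ n, Nat.find hex = n + 1 := by
      refine Nat.exists_eq_succ_of_ne_zero fun h => ?_
      have := Nat.find_spec hex
      rw [h, hb0] at this
      exact absurd this (Nat.not_lt_zero _)
    exact ⟨n, not_lt.1 (Nat.find_min hex (by omega)), hn ▸ Nat.find_spec hex⟩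
  -- By sparsity the orbit of `f` never jumps over an element of `S`.
  have hhit : ∀ m ∈ S, ∃ n, b n = m := by
    intro m hm
    obtain ⟨n, h1, h2⟩ := hloc m
    refine ⟨n, h1.antisymm (not_lt.1 fun h => ?_)⟩
    rw [hbs] at h2
    exact absurd (hfS _ m hm h) (not_le.2 h2)
  obtain ⟨z, hzc, hz1, hz2⟩ := exists_approx_sequence b hb c
  refine ⟨z, ⟨fun m hm => ?_, fun x hx => ?_⟩, hzc⟩
  · obtain ⟨n, rfl⟩ := hhit m hm
    obtain ⟨x, h1, h2, h3⟩ := hz1 n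
    refine ⟨x, ?_, ?_, ?_⟩
    · rw [Real.rpow_natCast]
      exact_mod_cast h1
    · rw [Real.rpow_add_one (by norm_num), Real.rpow_natCast]
      have : (x : ℝ) ≤ 2 * 16 ^ b n := by exact_mod_cast h2
      have : (0 : ℝ) < 16 ^ b n := by positivity
      linarith
    · refine h3.trans ?_
      rw [Real.rpow_sub (by norm_num), Real.rpow_one]
      gcongr
      · norm_num
      · rw [← Real.rpow_natCast, hbs]
        exact Real.rpow_le_rpow_of_exponent_le (by norm_num) (hf1 _ hm).1
  · have hxpos : (0 : ℝ) < |(x : ℝ)| := abs_pos.2 (by exact_mod_cast hx)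
    obtain ⟨n, h1, h2⟩ := hloc (Nat.log 16 x.natAbs)
    have h3 : 16 ^ b n ≤ |x| := by
      have := (Nat.pow_le_pow_right (by norm_num : 0 < 16) h1).trans
        (Nat.pow_log_le_self 16 (Int.natAbs_ne_zero.2 hx))
      rw [Int.abs_eq_natAbs]
      exact_mod_cast this
    have h4 : |x| < 16 ^ b (n + 1) := by
      have := (Nat.lt_pow_succ_log_self (by norm_num : 1 < 16) x.natAbs).trans_le
        (Nat.pow_le_pow_right (by norm_num : 0 < 16) h2)
      rw [Int.abs_eq_natAbs]
      exact_mod_cast this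
    have h3R : (16 : ℝ) ^ b n ≤ |(x : ℝ)| := by exact_mod_cast h3
    have h4R : |(x : ℝ)| < 16 ^ b (n + 1) := by exact_mod_cast h4
    have h5 := hz2 (n + 1) x hx h4
    by_cases hn : b n ∈ S
    · right
      have h6 : (16 : ℝ) ^ b (n + 1) ≤ 16 ^ (lam * b n + 1) := by
        rw [← Real.rpow_natCast, hbs]
        exact Real.rpow_le_rpow_of_exponent_le (by norm_num) (hf1 _ hn).2
      refine ⟨b n, hn, by rwa [Real.rpow_natCast], h4R.trans_le h6, le_trans ?_ h5⟩
      have e : (16 : ℝ) ^ (-(lam * b n + 2)) = (16 ^ (lam * b n + 1) * 16)⁻¹ := by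
        rw [Real.rpow_neg (by norm_num), ← Real.rpow_add_one (by norm_num)]
        ring_nf
      rw [e, ← one_div]
      apply one_div_le_one_div_of_le (by positivity)
      have : (0 : ℝ) < 16 ^ b (n + 1) := by positivity
      linarith
    · left
      refine le_trans ?_ h5
      rw [hbs, hf2 _ hn, pow_succ]
      have e : (16 : ℝ) ^ (-2 : ℝ) = 1 / 256 := by
        rw [Real.rpow_neg (by norm_num)]
        norm_num
      rw [e, ← one_div, div_mul_div_comm]
      apply div_le_div₀ <;> [norm_num; norm_num; positivity; linarith]

lemma not_countable_hasGaps {lam : ℝ} (hlam : 1 ≤ lam) {S : Set ℕ}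
    (hS : ∀ m ∈ S, ∀ m' ∈ S, m < m' → lam * m + 1 ≤ m') : ¬ {z | HasGaps lam S z}.Countable := by
  intro hc
  obtain ⟨z, hz, -⟩ := exists_hasGaps hlam hS 0
  obtain ⟨c, hc⟩ := hc.exists_eq_range ⟨z, hz⟩
  obtain ⟨y, hy, hyc⟩ := exists_hasGaps hlam hS c
  obtain ⟨n, hn⟩ : y ∈ Set.range c := hc ▸ hy
  exact hyc n hn.symm

/-! ### The exponent `λ₁` -/

lemma le_rpow_neg_of_le {x a μ : ℝ} (hμ : 0 ≤ μ) (hx0 : 0 < x) (hx : x ≤ (16 : ℝ) ^ a) :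
    16 ^ (-(μ * a)) ≤ x ^ (-μ) := by
  calc (16 : ℝ) ^ (-(μ * a)) = ((16 : ℝ) ^ a) ^ (-μ) := by
        rw [← Real.rpow_mul (by norm_num)]
        ring_nf
    _ ≤ x ^ (-μ) := Real.rpow_le_rpow_of_nonpos hx0 hx (by linarith)

lemma exists_nat_large_mem {S : Set ℕ} (hS : S.Infinite) (B : ℝ) : ∃ m ∈ S, B < m := by
  obtain ⟨n, hn⟩ := exists_nat_gt B
  obtain ⟨m, hm, hnm⟩ := hS.exists_gt n
  exact ⟨m, hm, hn.trans (by exact_mod_cast hnm)⟩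

/-- Large approximations of exponent `μ > 1` come from the indices in `S`; the bound may involve
a number `X` larger than the denominator. -/
lemma HasGaps.exists_of_le {lam μ : ℝ} {S : Set ℕ} {z : ℝ} (h : HasGaps lam S z) (hμ : 1 < μ)
    {x : ℤ} (hx : x ≠ 0) {X : ℝ} (hxX : |(x : ℝ)| ≤ X) (hX : (16 : ℝ) ^ (2 / (μ - 1)) < X)
    (hd : distInt (x * z) ≤ X ^ (-μ)) :
    ∃ m ∈ S, (16 : ℝ) ^ (m : ℝ) ≤ |(x : ℝ)| ∧ |(x : ℝ)| < 16 ^ (lam * m + 1) ∧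
      X ≤ 16 ^ ((lam * m + 2) / μ) := by
  have hxpos : (0 : ℝ) < |(x : ℝ)| := abs_pos.2 (by exact_mod_cast hx)
  have hXpos : 0 < X := hxpos.trans_le hxX
  obtain ⟨a, rfl⟩ : ∃ a : ℝ, (16 : ℝ) ^ a = X :=
    ⟨Real.logb 16 X, Real.rpow_logb (by norm_num) (by norm_num) hXpos⟩
  rw [← Real.rpow_mul (by norm_num)] at hd
  rw [Real.rpow_lt_rpow_left_iff (by norm_num), div_lt_iff₀ (by linarith)] at hX
  rcases h.2 x hx with h1 | ⟨m, hm, h1, h2, h3⟩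
  · exfalso
    have h4 : (16 : ℝ) ^ (-2 - a) ≤ 16 ^ (a * -μ) := by
      refine le_trans ?_ (h1.trans hd)
      rw [sub_eq_add_neg, Real.rpow_add (by norm_num), Real.rpow_neg (by norm_num) a]
      gcongr
    rw [Real.rpow_le_rpow_left_iff (by norm_num)] at h4
    linarith
  · refine ⟨m, hm, h1, h2, ?_⟩
    have h4 := h3.trans hd
    rw [Real.rpow_le_rpow_left_iff (by norm_num)] at h4 ⊢
    rw [le_div_iff₀ (by linarith)]
    linarith

lemma HasGaps.lambdaOne_eq {lam : ℝ} (hlam : 1 ≤ lam) {S : Set ℕ} (hS : S.Infinite) {z : ℝ}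
    (h : HasGaps lam S z) : lambdaOne z = lam := by
  apply le_antisymm
  · refine sSup_le ?_
    rintro _ ⟨μ, rfl, hfr⟩
    rw [EReal.coe_le_coe_iff]
    by_contra! hlt
    have hμ : 1 < μ := by linarith
    have htend := tendsto_natCast_atTop_atTop (R := ℝ)
    obtain ⟨x, hd, hx1, hx2, hx3⟩ := (hfr.and_eventually
      ((htend.eventually_gt_atTop ((16 : ℝ) ^ (2 / (μ - 1)))).and
      ((htend.eventually_gt_atTop ((16 : ℝ) ^ (lam * (2 / (μ - lam)) + 1))).and
      (eventually_gt_atTop 0)))).exists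
    obtain ⟨m, -, h1, h2, h3⟩ := h.exists_of_le hμ (x := x) (by exact_mod_cast hx3.ne')
      (X := x) (by simp) hx1 (by exact_mod_cast hd)
    simp only [Int.cast_natCast, Nat.abs_cast] at h1 h2
    have h4 := h1.trans h3
    rw [Real.rpow_le_rpow_left_iff (by norm_num), le_div_iff₀ (by linarith)] at h4
    have h5 := hx2.trans h2
    rw [Real.rpow_lt_rpow_left_iff (by norm_num)] at h5
    -- An exponent above `lam` bounds `m`, hence also `x < 16 ^ (lam * m + 1)`.
    have h6 : (m : ℝ) ≤ 2 / (μ - lam) := by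
      rw [le_div_iff₀ (by linarith)]
      linarith
    have := mul_le_mul_of_nonneg_left h6 (by linarith : 0 ≤ lam)
    linarith
  · refine le_of_forall_lt fun c hc => ?_
    have hc' : max c 0 < (lam : EReal) := max_lt hc (by exact_mod_cast (by linarith : 0 < lam))
    obtain ⟨μ, hμ1, hμ2⟩ := EReal.lt_iff_exists_real_btwn.1 hc'
    have hμ0 : 0 < μ := by exact_mod_cast (le_max_right c 0).trans_lt hμ1
    have hμlam : μ < lam := by exact_mod_cast hμ2
    refine ((le_max_left c 0).trans_lt hμ1).trans_le (le_sSup ⟨μ, rfl, ?_⟩)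
    rw [frequently_atTop]
    intro N
    obtain ⟨m, hm, hBm⟩ := exists_nat_large_mem hS (max N ((1 + μ) / (lam - μ)))
    obtain ⟨x, h1, h2, h3⟩ := h.1 m hm
    have hxpos : (0 : ℝ) < x := lt_of_lt_of_le (by positivity) h1
    refine ⟨x, ?_, h3.trans (le_trans ?_ (le_rpow_neg_of_le hμ0.le hxpos h2))⟩
    · have h4 : (m : ℝ) ≤ 16 ^ (m : ℝ) := by
        rw [Real.rpow_natCast]
        exact_mod_cast (Nat.lt_pow_self (by norm_num : 1 < 16)).le
      have := (le_max_left _ _).trans (hBm.le.trans (h4.trans h1))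
      exact_mod_cast this
    · rw [Real.rpow_le_rpow_left_iff (by norm_num)]
      have h5 := (le_max_right _ _).trans_lt hBm
      rw [div_lt_iff₀ (by linarith)] at h5
      linarith

/-! ### Linear independence and uncountability -/

/-- The rational span of finitely many reals is countable, so each new coordinate can be chosen
outside it. -/
lemma exists_linearIndependent_cons_one (k : ℕ) (F : Fin k → Set ℝ) (hF : ∀ j, ¬ (F j).Countable) :
    ∃ ζ : Fin k → ℝ, LinearIndependent ℚ (Fin.cons 1 ζ : Fin (k + 1) → ℝ) ∧ ∀ j, ζ j ∈ F j := by
  induction k with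
  | zero =>
    refine ⟨Fin.elim0, ?_, fun j => j.elim0⟩
    have : Subsingleton (Fin (0 + 1)) := inferInstanceAs (Subsingleton (Fin 1))
    exact LinearIndependent.of_subsingleton 0 one_ne_zero
  | succ k ih =>
    obtain ⟨ζ, h1, h2⟩ := ih (fun j => F j.castSucc) fun j => hF _
    have hcount : (Submodule.span ℚ (Set.range (Fin.cons 1 ζ : Fin (k + 1) → ℝ)) :
        Set ℝ).Countable :=
      Set.countable_coe_iff.1 (inferInstanceAs (Countable (Submodule.span ℚ (Set.range _))))
    obtain ⟨y, hy, hy'⟩ : ∃ y ∈ F (Fin.last k),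
        y ∉ Submodule.span ℚ (Set.range (Fin.cons 1 ζ : Fin (k + 1) → ℝ)) := by
      by_contra! hsub
      exact hF _ (hcount.mono hsub)
    refine ⟨Fin.snoc ζ y, ?_, fun j => ?_⟩
    · rw [Fin.cons_snoc_eq_snoc_cons, linearIndependent_finSnoc]
      exact ⟨h1, hy'⟩
    · induction j using Fin.lastCases with
      | last => simpa using hy
      | cast j => simpa using h2 j

/-- If the set were countable, deleting its `j₀`-coordinates from `F j₀` would leave an uncountable
set, and a vector chosen there would be a new member. -/
lemma not_countable_linearIndependent_cons_one (k : ℕ) (j₀ : Fin k) (F : Fin k → Set ℝ)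
    (hF : ∀ j, ¬ (F j).Countable) :
    ¬ {ζ : Fin k → ℝ | LinearIndependent ℚ (Fin.cons 1 ζ : Fin (k + 1) → ℝ) ∧
      ∀ j, ζ j ∈ F j}.Countable := by
  intro hc
  obtain ⟨ζ, h1, h2⟩ := exists_linearIndependent_cons_one k
    (Function.update F j₀ (F j₀ \ (fun ζ => ζ j₀) '' {ζ : Fin k → ℝ |
      LinearIndependent ℚ (Fin.cons 1 ζ : Fin (k + 1) → ℝ) ∧ ∀ j, ζ j ∈ F j})) (fun j => by
        by_cases hj : j = j₀
        · subst hj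
          rw [Function.update_self]
          intro hd
          exact hF j ((hd.union (hc.image fun ζ => ζ j)).mono fun z hz =>
            or_iff_not_imp_right.2 fun h => ⟨hz, h⟩)
        · rw [Function.update_of_ne hj]
          exact hF j)
  have h3 := h2 j₀
  rw [Function.update_self] at h3
  refine h3.2 ⟨ζ, ⟨h1, fun j => ?_⟩, rfl⟩
  by_cases hj : j = j₀
  · exact hj ▸ h3.1
  · simpa [hj] using h2 j

/-! ### The exponent `χ_k` -/

lemma chiExponent_eq_of_hasGaps {k : ℕ} {i₀ i₁ : Fin k} (hi : i₁ ≠ i₀) {lam : Fin k → ℝ} {w : ℝ}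
    (hw : 1 ≤ w) (hwlam : ∀ j, w ≤ lam j) {t s : ℕ → ℕ} (ht : StrictMono t) (hs : Monotone s)
    (hs1 : ∀ i, lam i₀ * t i ≤ w * s i) (hs2 : ∀ i, w * s i ≤ lam i₀ * t i + w)
    (hts : ∀ i, lam i₁ * s i + 2 < t (i + 1))
    {ζ : Fin k → ℝ} (h₀ : HasGaps (lam i₀) (Set.range t) (ζ i₀))
    (h₁ : ∀ j ≠ i₀, HasGaps (lam j) (Set.range s) (ζ j)) :
    chiExponent k ζ = w := by
  have hlam : ∀ j, 1 ≤ lam j := fun j => hw.trans (hwlam j)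
  have hts' : ∀ i, (t i : ℝ) ≤ s i := by
    intro i
    have h1 := mul_le_mul_of_nonneg_right (hwlam i₀) (Nat.cast_nonneg (t i) : (0 : ℝ) ≤ t i)
    exact le_of_mul_le_mul_left (h1.trans (hs1 i)) (by linarith)
  apply le_antisymm
  · refine sSup_le ?_
    rintro _ ⟨ν, rfl, -, hfr⟩
    rw [EReal.coe_le_coe_iff]
    by_contra! hlt
    have hν : 1 < ν := by linarith
    obtain ⟨X, ⟨x, hx⟩, hX1, hX2⟩ := (hfr.and_eventually
      ((eventually_gt_atTop ((16 : ℝ) ^ (2 / (ν - 1)))).and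
      (eventually_gt_atTop ((16 : ℝ) ^ (2 * w / (ν - w) + 2))))).exists
    have main : ∀ j, ∀ S, HasGaps (lam j) S (ζ j) → ∃ m ∈ S, (16 : ℝ) ^ (m : ℝ) ≤ X ∧
        X ≤ 16 ^ ((lam j * m + 2) / ν) := by
      intro j S hj
      obtain ⟨hj1, hj2, hj3⟩ := hx j
      obtain ⟨m, hm, h1, -, h3⟩ := hj.exists_of_le hν (abs_pos.1 hj1) hj2 hX1 hj3
      exact ⟨m, hm, h1.trans hj2, h3⟩
    obtain ⟨_, ⟨a, rfl⟩, ha1, ha2⟩ := main i₀ _ h₀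
    obtain ⟨_, ⟨b, rfl⟩, hb1, hb2⟩ := main i₁ _ (h₁ i₁ hi)
    have hab := ha1.trans hb2
    have hba := hb1.trans ha2
    have haa := hX2.trans_le ha2
    rw [Real.rpow_le_rpow_left_iff (by norm_num), le_div_iff₀ (by linarith)] at hab hba
    rw [Real.rpow_lt_rpow_left_iff (by norm_num), lt_div_iff₀ (by linarith)] at haa
    rcases le_or_gt a b with h | h
    -- Here `X ≥ 16 ^ s a`, where the approximation from `t a` is worth only about `X ^ (-w)`; this
    -- bounds `s a`, hence `X`.
    · have h1 : (s a : ℝ) ≤ s b := by exact_mod_cast hs h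
      have h2 : (s a : ℝ) * (ν - w) ≤ 2 := by
        have := mul_le_mul_of_nonneg_right h1 (by linarith : 0 ≤ ν)
        linarith [hs1 a]
      have h3 : (2 * w / (ν - w) + 2) ≤ (2 * w / (ν - w) + 2) * ν := by
        have : 0 ≤ 2 * w / (ν - w) := div_nonneg (by linarith) (by linarith)
        nlinarith
      have h4 : lam i₀ * t a ≤ 2 * w / (ν - w) := by
        rw [le_div_iff₀ (by linarith)]
        have e1 := mul_le_mul_of_nonneg_right (hs1 a) (by linarith : 0 ≤ ν - w)
        have e2 := mul_le_mul_of_nonneg_left h2 (by linarith : 0 ≤ w)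
        linarith
      linarith
    -- Here the approximation from `s b` is exhausted before scale `16 ^ t (b + 1)`.
    · have h1 : (t (b + 1) : ℝ) ≤ t a := by exact_mod_cast ht.monotone (Nat.succ_le_of_lt h)
      have h2 : (t a : ℝ) ≤ t a * ν := le_mul_of_one_le_right (Nat.cast_nonneg _) hν.le
      linarith [hts b]
  · refine le_of_forall_lt fun c hc => ?_
    have hc' : max c 0 < (w : EReal) := max_lt hc (by exact_mod_cast (by linarith : 0 < w))
    obtain ⟨ν, hν1, hν2⟩ := EReal.lt_iff_exists_real_btwn.1 hc'
    have hν0 : 0 < ν := by exact_mod_cast (le_max_right c 0).trans_lt hν1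
    have hνw : ν < w := by exact_mod_cast hν2
    refine ((le_max_left c 0).trans_lt hν1).trans_le (le_sSup ⟨ν, rfl, hν0, ?_⟩)
    refine frequently_atTop.2 fun N => ?_
    obtain ⟨_, ⟨i, rfl⟩, hBi⟩ := exists_nat_large_mem (Set.infinite_range_of_injective ht.injective)
      -- This threshold makes `1 - (w * s i - w) ≤ -ν * (s i + 1)`, absorbing the bounded factors
      -- and the rounding in `s`.
      (max N ((1 + ν + w) / (w - ν)))
    have hBs := hBi.trans_le (hts' i)
    have hNs := (le_max_left _ _).trans_lt hBs
    have hνs := (le_max_right _ _).trans_lt hBs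
    rw [div_lt_iff₀ (by linarith)] at hνs
    have key : ∀ j, ∃ x : ℕ, 0 < x ∧ (x : ℝ) ≤ 16 ^ (s i + 1 : ℝ) ∧
        distInt (x * ζ j) ≤ ((16 : ℝ) ^ (s i + 1 : ℝ)) ^ (-ν) := by
      have hrp : ∀ r : ℝ, w * s i - w ≤ r →
          (16 : ℝ) ^ (1 - r) ≤ ((16 : ℝ) ^ (s i + 1 : ℝ)) ^ (-ν) := by
        intro r hr
        rw [← Real.rpow_mul (by norm_num), Real.rpow_le_rpow_left_iff (by norm_num)]
        linarith
      intro j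
      by_cases hj : j = i₀
      · subst hj
        obtain ⟨x, h1, h2, h3⟩ := h₀.1 (t i) ⟨i, rfl⟩
        refine ⟨x, ?_, h2.trans ?_, h3.trans (hrp _ (by linarith [hs2 i]))⟩
        · have : (0 : ℝ) < x := lt_of_lt_of_le (by positivity) h1
          exact_mod_cast this
        · rw [Real.rpow_le_rpow_left_iff (by norm_num)]
          linarith [hts' i]
      · obtain ⟨x, h1, h2, h3⟩ := (h₁ j hj).1 (s i) ⟨i, rfl⟩
        refine ⟨x, ?_, h2, h3.trans (hrp _ ?_)⟩
        · have : (0 : ℝ) < x := lt_of_lt_of_le (by positivity) h1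
          exact_mod_cast this
        · have := mul_le_mul_of_nonneg_right (hwlam j) (Nat.cast_nonneg (s i) : (0 : ℝ) ≤ s i)
          linarith
    choose x hx1 hx2 hx3 using key
    refine ⟨16 ^ (s i + 1 : ℝ), ?_, fun j => (x j : ℤ), fun j => ⟨?_, ?_, ?_⟩⟩
    · have h4 : (s i : ℝ) ≤ 16 ^ (s i : ℝ) := by
        rw [Real.rpow_natCast]
        exact_mod_cast (Nat.lt_pow_self (by norm_num : 1 < 16)).le
      have h5 : (16 : ℝ) ^ (s i : ℝ) ≤ 16 ^ (s i + 1 : ℝ) := by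
        rw [Real.rpow_le_rpow_left_iff (by norm_num)]
        linarith
      linarith
    · exact abs_pos.2 (Int.natCast_ne_zero.2 (hx1 j).ne')
    · simpa using hx2 j
    · simpa using hx3 j

/-! ### Choice of the sparse sets -/

theorem mainTheorem4 (k : ℕ) (hk : 2 ≤ k) (lam : Fin k → ℝ) (w : ℝ)
    (hw : 1 ≤ w) (hwlam : ∀ j, w ≤ lam j) :
    ¬ Set.Countable {ζ : Fin k → ℝ |
      LinearIndependent ℚ (Fin.cons 1 ζ : Fin (k + 1) → ℝ) ∧
      (∀ j, lambdaOne (ζ j) = (lam j : EReal)) ∧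
      chiExponent k ζ = (w : EReal)} := by
  obtain ⟨i₀, hi₀⟩ : ∃ i : Fin k, i = ⟨0, by omega⟩ := ⟨_, rfl⟩
  obtain ⟨i₁, hi₁⟩ : ∃ i : Fin k, i ≠ i₀ := ⟨⟨1, by omega⟩, by simp [hi₀]⟩
  have hlam : ∀ j, 1 ≤ lam j := fun j => hw.trans (hwlam j)
  obtain ⟨L, hL⟩ : ∃ L : ℝ, ∀ j, lam j ≤ L := (Set.finite_range lam).bddAbove.imp
    fun L hL j => hL ⟨j, rfl⟩
  have hL1 : 1 ≤ L := (hlam i₀).trans (hL i₀)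
  -- Since `s i ≤ (L + 1) * t i` and `1 ≤ t i`, this ratio gives `lam j * s i + 2 < t (i + 1)`.
  obtain ⟨M, hM⟩ := exists_nat_gt (L * (L + 1) + 2)
  have hM2 : (2 : ℝ) < M := by nlinarith
  obtain ⟨t, ht⟩ : ∃ t : ℕ → ℕ, t = fun i => M ^ i := ⟨_, rfl⟩
  have hM1 : 1 < M := by
    have : (1 : ℝ) < M := by linarith
    exact_mod_cast this
  have htm : StrictMono t := by
    rw [ht]
    exact pow_right_strictMono₀ hM1
  have htpos : ∀ i, (1 : ℝ) ≤ t i := fun i => by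
    rw [ht]
    exact_mod_cast Nat.one_le_pow _ _ (by omega)
  have htM : ∀ i, (t (i + 1) : ℝ) = M * t i := fun i => by
    rw [ht]
    push_cast
    ring
  obtain ⟨s, hs⟩ : ∃ s : ℕ → ℕ, s = fun i => ⌈lam i₀ * t i / w⌉₊ := ⟨_, rfl⟩
  have hw0 : 0 < w := by linarith
  have hlam0 : 0 < lam i₀ := by linarith [hlam i₀]
  have hs1 : ∀ i, lam i₀ * t i ≤ w * s i := by
    intro i
    have := Nat.le_ceil (lam i₀ * t i / w)
    rw [div_le_iff₀ hw0] at this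
    rw [hs]
    linarith
  have hs2 : ∀ i, w * s i ≤ lam i₀ * t i + w := by
    intro i
    have := (Nat.ceil_lt_add_one (a := lam i₀ * t i / w) (by positivity)).le
    have := mul_le_mul_of_nonneg_left this hw0.le
    rw [mul_add, mul_div_cancel₀ _ hw0.ne'] at this
    rw [hs]
    linarith
  have hts : ∀ i, (t i : ℝ) ≤ s i := by
    intro i
    have h1 := mul_le_mul_of_nonneg_right (hwlam i₀) (Nat.cast_nonneg (t i) : (0 : ℝ) ≤ t i)
    exact le_of_mul_le_mul_left (h1.trans (hs1 i)) hw0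
  have hsL : ∀ i, (s i : ℝ) ≤ (L + 1) * t i := by
    intro i
    have h1 := mul_le_mul_of_nonneg_right (hL i₀) (Nat.cast_nonneg (t i) : (0 : ℝ) ≤ t i)
    have h2 : (L : ℝ) * t i ≤ w * (L * t i) := le_mul_of_one_le_left (by positivity) hw
    have h3 := mul_le_mul_of_nonneg_left (htpos i) hw0.le
    refine le_of_mul_le_mul_left ?_ hw0
    linarith [hs2 i]
  have hgap : ∀ j i, lam j * s i + 2 < t (i + 1) := by
    intro j i
    have h1 := mul_le_mul (hL j) (hsL i) (Nat.cast_nonneg _) (by linarith)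
    have h2 := mul_lt_mul_of_pos_right hM (by linarith [htpos i] : (0 : ℝ) < t i)
    rw [htM]
    linarith [htpos i]
  have hsm : StrictMono s := strictMono_nat_of_lt_succ fun i => by
    have h1 := mul_le_mul_of_nonneg_right (hlam i₀) (Nat.cast_nonneg (s i) : (0 : ℝ) ≤ s i)
    have : (s i : ℝ) < s (i + 1) := by linarith [hgap i₀ i, hts (i + 1)]
    exact_mod_cast this
  have hsparse : ∀ (l : ℝ) (u : ℕ → ℕ), StrictMono u → (∀ i, l * u i + 1 ≤ u (i + 1)) →
      ∀ m ∈ Set.range u, ∀ m' ∈ Set.range u, m < m' → l * m + 1 ≤ m' := by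
    rintro l u hu h _ ⟨a, rfl⟩ _ ⟨b, rfl⟩ hab
    have h1 : (u (a + 1) : ℝ) ≤ u b := by
      exact_mod_cast hu.monotone (Nat.succ_le_of_lt (hu.lt_iff_lt.1 hab))
    exact (h a).trans h1
  let S : Fin k → Set ℕ := fun j => if j = i₀ then Set.range t else Set.range s
  have hSinf : ∀ j, (S j).Infinite := by
    intro j
    by_cases hj : j = i₀
    · simpa only [S, if_pos hj] using Set.infinite_range_of_injective htm.injective
    · simpa only [S, if_neg hj] using Set.infinite_range_of_injective hsm.injective
  refine fun hc => not_countable_linearIndependent_cons_one k i₀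
    (fun j => {z | HasGaps (lam j) (S j) z}) (fun j => not_countable_hasGaps (hlam j) ?_)
    (hc.mono ?_)
  · by_cases hj : j = i₀
    · simp only [S, if_pos hj]
      refine hsparse _ _ htm fun i => ?_
      have := mul_le_mul_of_nonneg_left (hts i) (by linarith [hlam j] : 0 ≤ lam j)
      linarith [hgap j i]
    · simp only [S, if_neg hj]
      refine hsparse _ _ hsm fun i => ?_
      linarith [hgap j i, hts (i + 1)]
  · rintro ζ ⟨h1, h2⟩
    refine ⟨h1, fun j => HasGaps.lambdaOne_eq (hlam j) (hSinf j) (h2 j), ?_⟩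
    refine chiExponent_eq_of_hasGaps hi₁ hw hwlam htm hsm.monotone hs1 hs2 (hgap i₁) ?_ ?_
    · simpa only [S, if_pos rfl, Set.mem_ofPred_eq] using h2 i₀
    · intro j hj
      have := h2 j
      simpa only [S, if_neg hj, Set.mem_ofPred_eq] using this
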